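/- Let $a,b,c,d\ge 0$ be real weights with $a+c=b+d>0$, and put $p=\frac{a}{a+c}$ and $r=\frac{b}{b+d}$, both in $[0,1]$. Let $\mathcal L(\mathrm{PM}(1/2);p,r)$ be the law of the random field $(e(i,t))_{i\in\mathbb Z,\,t\in\mathbb N}$ with values in $\{0,1\}$ defined as follows. The variables $e(i,0)$, $i\in\mathbb Z$, are i.i.d. Bernoulli of parameter $1/2$, and the lines $(e(i,t))_{i\in\mathbb Z}$, $t=0,1,2,\dots$, form a Markov chain. In the step from $t$ to $t+1$ the line is divided into the pairs of abscissas $(2j,2j+1)$, $j\in\mathbb Z$, if $t$ is even, and $(2j-1,2j)$, $j\in\mathbb Z$, if $t$ is odd. Given line $t$, the pairs evolve independently of one another: for $k\in\{0,1\}$, a pair in state $(k,k)$ stays $(k,k)$ with probability $r$ and becomes $(1-k,1-k)$ with probability $1-r$; a pair in state $(k,1-k)$ becomes $(1-k,k)$ with probability $p$ and stays $(k,1-k)$ with probability $1-p$. This is the law of the 8-vertex model with local weights $a,b,c,d$, with $a+c=b+d$ and free boundary condition, on the half-plane lattice; $e(i,t)=1$ means that the edge $(i,t)$ is up-oriented.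 Its edge correlation function is $$C_8(i,t)=\frac{\mathrm{Cov}\big(e(0,0),e(i,t)\big)}{\sqrt{\mathrm{Var}\,e(0,0)}\,\sqrt{\mathrm{Var}\,e(i,t)}} .$$ Let $\lambda=\max\big(|1-2p|,|1-2r|\big)$. **Theorem.** The condition "$a=d$ and $b=c$" is equivalent to $p+r=1$. For every $i\in\mathbb Z$: - if $a=d$ and $b=c$, then for every $t\in\mathbb N$, $C_8(i,t)=(1-2p)^t$ if $i=0$, and $C_8(i,t)=0$ if $i\ne 0$; - otherwise, $C_8(i,t)=O\big(\lambda^t/\sqrt t\,\big)$ as $t\to\infty$ (with $i$ and $a,b,c,d$ fixed). Moreover, if $a,b,c,d$ are all positive then $\lambda<1$, so that the decay is exponential; if $d=0$ (the 6-vertex model) then $\lambda=1$, so that in the second case the bound reads $C_8(i,t)=O(1/\sqrt t)$. -/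

import Mathlib

open MeasureTheory ProbabilityTheory Filter Asymptotics
open scoped NNReal ENNReal unitInterval

namespace EightVertex

/-- The states `e(i,t)`, `i ∈ ℤ`, of the edges of one line `t` of the half-plane lattice:
`true` (state `1`) is an up-oriented edge, `false` (state `0`) a down-oriented edge. -/
abbrev Line : Type := ℤ → Bool

/-- An orientation of all the edges `(i,t) ∈ ℤ × ℕ` of the half-plane lattice: `ω t i` is the
state `e(i,t)`. -/
abbrev Orientation : Type := ℕ → Line

/-- The product measure `PM(q)` on `{0,1}^ℤ`: the states are i.i.d. Bernoulli of parameter `q`. -/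
noncomputable def productBernoulli (q : I) : Measure Line :=
  Measure.infinitePi fun _ : ℤ ↦ bernoulliMeasure true false q

instance (q : I) : IsProbabilityMeasure (productBernoulli q) := by
  unfold productBernoulli; infer_instance

/-- The transition at one vertex: the law of the pair of states on line `t + 1`, given the pair
`s` of states on line `t`. A pair `(k, k)` is kept with probability `r` and becomes
`(1 - k, 1 - k)` with probability `1 - r`; a pair `(k, 1 - k)` becomes `(1 - k, k)` with
probability `p` and is kept with probability `1 - p`. -/
noncomputable def vertexLaw (p r : I) (s : Bool × Bool) : Measure (Bool × Bool) :=
  if s.1 = s.2 then bernoulliMeasure s (!s.1, !s.2) r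
  else bernoulliMeasure (!s.1, !s.2) s p

instance (p r : I) (s : Bool × Bool) : IsProbabilityMeasure (vertexLaw p r s) := by
  unfold vertexLaw; split_ifs <;> infer_instance

/-- The `j`-th pair of a line read at a time of parity `u`: the pair of abscissas `(2j, 2j+1)` if
`u = 0`, and `(2j-1, 2j)` if `u = 1`. -/
def pairAt (u : ℤ) (x : Line) (j : ℤ) : Bool × Bool := (x (2 * j - u), x (2 * j - u + 1))

/-- The line made of given pairs (inverse of `pairAt u`). -/
def ofPairs (u : ℤ) (z : ℤ → Bool × Bool) : Line := fun i ↦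
  if (i + u) % 2 = 0 then (z ((i + u) / 2)).1 else (z ((i + u) / 2)).2

theorem ofPairs_pairAt (u : ℤ) (x : Line) : ofPairs u (pairAt u x) = x := by
  funext i
  unfold ofPairs pairAt
  split_ifs with h
  · exact congrArg x (by omega)
  · exact congrArg x (by omega)

theorem pairAt_ofPairs (u : ℤ) (z : ℤ → Bool × Bool) : pairAt u (ofPairs u z) = z := by
  funext j
  have h1 : (2 * j - u + u) % 2 = 0 := by omega
  have h2 : ¬ (2 * j - u + 1 + u) % 2 = 0 := by omega
  have h3 : (2 * j - u + u) / 2 = j := by omega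
  have h4 : (2 * j - u + 1 + u) / 2 = j := by omega
  simp only [ofPairs, pairAt, if_pos h1, if_neg h2, h3, h4]

theorem measurable_ofPairs (u : ℤ) : Measurable (ofPairs u) := by
  refine measurable_pi_lambda _ fun i ↦ ?_
  unfold ofPairs
  split_ifs <;> fun_prop

/-- The law of line `t + 1` given line `t = x`, where `u` is the parity of `t`: the pairs evolve
independently of one another, each of them by `vertexLaw p r`. -/
noncomputable def lineLaw (p r : I) (u : ℤ) (x : Line) : Measure Line :=
  (Measure.infinitePi fun j : ℤ ↦ vertexLaw p r (pairAt u x j)).map (ofPairs u)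

instance (p r : I) (u : ℤ) (x : Line) : IsProbabilityMeasure (lineLaw p r u x) :=
  Measure.isProbabilityMeasure_map (measurable_ofPairs u).aemeasurable

theorem measurable_lineLaw (p r : I) (u : ℤ) : Measurable (lineLaw p r u) := by
  have hpair : ∀ j, Measurable fun x : Line ↦ pairAt u x j := fun j ↦ by
    unfold pairAt; fun_prop
  refine (Measure.measurable_map _ (measurable_ofPairs u)).comp ?_
  refine Measurable.measure_of_isPiSystem_of_isProbabilityMeasure
    (generateFrom_squareCylinders (α := fun _ : ℤ ↦ Bool × Bool)).symm
    (isPiSystem_squareCylinders (fun _ ↦ MeasurableSpace.isPiSystem_measurableSet)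
      (fun _ ↦ by simp)) ?_
  rintro _ ⟨s, t, ht, rfl⟩
  have ht' : ∀ j, MeasurableSet (t j) := fun j ↦ ht j (Set.mem_univ j)
  simp_rw [Measure.infinitePi_pi _ fun j _ ↦ ht' j]
  refine Finset.measurable_prod _ fun j _ ↦ ?_
  exact (measurable_of_countable fun s : Bool × Bool ↦ vertexLaw p r s (t j)).comp (hpair j)

/-- The transition kernel of the Markov chain of lines, from time `t` (with the whole past) to
time `t + 1`. -/
noncomputable def lineKernel (p r : I) (t : ℕ) : Kernel (Π _ : Finset.Iic t, Line) Line where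
  toFun h := lineLaw p r (t % 2 : ℕ) (h ⟨t, Finset.mem_Iic.2 le_rfl⟩)
  measurable' := (measurable_lineLaw p r _).comp (measurable_pi_apply _)

instance (p r : I) (t : ℕ) : IsMarkovKernel (lineKernel p r t) :=
  ⟨fun h ↦ by change IsProbabilityMeasure (lineLaw p r _ _); infer_instance⟩

/-- The law `𝓛(μ; p, r)` on orientations: line `0` has law `μ`, and the lines form a Markov chain
with transitions `lineLaw p r (t mod 2)`. -/
noncomputable def orientationLaw (μ : Measure Line) (p r : I) : Measure Orientation :=
  Kernel.trajMeasure (X := fun _ ↦ Line) μ (lineKernel p r)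

/-- The number `x / (x + y) ∈ [0,1]`. -/
noncomputable def ratio (x y : ℝ≥0) : I :=
  ⟨(x : ℝ) / (x + y), unitInterval.div_mem x.2 (add_nonneg x.2 y.2)
    (le_add_of_nonneg_right y.2)⟩

/-- The 8-vertex law on the half-plane with local weights `a, b, c, d` such that `a + c = b + d`
and free boundary condition: `𝓛(PM(1/2); a/(a+c), b/(b+d))`. -/
noncomputable def eightVertexLaw (a b c d : ℝ≥0) : Measure Orientation :=
  orientationLaw (productBernoulli ⟨1 / 2, by norm_num, by norm_num⟩) (ratio a c) (ratio b d)

/-- The random variable `e(i,t) ∈ {0,1}`. -/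
def edge (i : ℤ) (t : ℕ) (ω : Orientation) : ℝ := if ω t i then 1 else 0

/-- The edge correlation function `C((i,t);(i',t'))` of a law on orientations. -/
noncomputable def edgeCorrelation (P : Measure Orientation) (i : ℤ) (t : ℕ) (i' : ℤ) (t' : ℕ) :
    ℝ :=
  covariance (edge i t) (edge i' t') P /
    (Real.sqrt (variance (edge i t) P) * Real.sqrt (variance (edge i' t') P))

/-- `C₈(i,t) = C₈((0,0);(i,t))`. -/
noncomputable def C8 (a b c d : ℝ≥0) (i : ℤ) (t : ℕ) : ℝ :=
  edgeCorrelation (eightVertexLaw a b c d) 0 0 i t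

/-- `λ(p,r) = max(|1-2p|, |1-2r|)`. -/
noncomputable def decayRate (p r : ℝ) : ℝ := max |1 - 2 * p| |1 - 2 * r|

end EightVertex

namespace EightVertex

/-! With α = r - p and β = r + p - 1, the conditional mean of a spin after one step is α times the
old spin plus β times its partner's. Hence C₈ equals `corr α β`, a deterministic recursion started
from the indicator of 0, and λ = |α| + |β| (`decayRate_eq`). If β = 0, nothing propagates. If α = 0,
the correlation sits on i = t and leaves every fixed abscissa. Otherwise two steps act as 2αβ `avg`
+ `hop` (`corr_two_mul_succ`): `avg` is a simple random walk step, and `hop` has sup norm at most α²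
+ β². `avg` commutes with `hop` up to parity (`avg_hop`), so the walk steps collect on the initial
indicator, where k of them give at most 1/√(k+1). `abs_iterate_avg_corr_le` turns this into the
factor 1/√t by induction. -/

/-- The spin `±1` of an edge state. -/
def spin (b : Bool) : ℝ := if b then 1 else -1

theorem spin_mul_self (b : Bool) : spin b * spin b = 1 := by cases b <;> simp [spin]

theorem norm_spin (b : Bool) : ‖spin b‖ = 1 := by cases b <;> simp [spin]

theorem measurable_spin : Measurable spin := measurable_of_countable _

theorem measurable_spin_apply (i : ℤ) : Measurable fun x : Line ↦ spin (x i) :=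
  measurable_spin.comp (measurable_pi_apply i)

/-! ### One step of the chain on spins -/

/-- The abscissa paired with `x` at a time of parity `u`. -/
def partner (u x : ℤ) : ℤ := if (x + u) % 2 = 0 then x + 1 else x - 1

/-- The mean is (2r - 1) = α + β times the spin on equal pairs and (1 - 2p) = α - β times it on
opposite pairs; both cases are one linear form in the two spins. -/
theorem integral_spin_fst_vertexLaw (p r : I) (s : Bool × Bool) :
    ∫ z, spin z.1 ∂vertexLaw p r s =
      ((r : ℝ) - p) * spin s.1 + ((r : ℝ) + p - 1) * spin s.2 := by
  obtain ⟨s₁, s₂⟩ := s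
  cases s₁ <;> cases s₂ <;> simp [vertexLaw, integral_bernoulliMeasure, spin] <;> ring

theorem integral_spin_snd_vertexLaw (p r : I) (s : Bool × Bool) :
    ∫ z, spin z.2 ∂vertexLaw p r s =
      ((r : ℝ) - p) * spin s.2 + ((r : ℝ) + p - 1) * spin s.1 := by
  obtain ⟨s₁, s₂⟩ := s
  cases s₁ <;> cases s₂ <;> simp [vertexLaw, integral_bernoulliMeasure, spin] <;> ring

theorem integral_spin_lineLaw (p r : I) (u : ℤ) (x : Line) (i : ℤ) :
    ∫ y, spin (y i) ∂lineLaw p r u x =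
      ((r : ℝ) - p) * spin (x i) + ((r : ℝ) + p - 1) * spin (x (partner u i)) := by
  have hev (f : Bool × Bool → ℝ) (j : ℤ) :
      ∫ z, f (z j) ∂Measure.infinitePi (fun j : ℤ ↦ vertexLaw p r (pairAt u x j)) =
        ∫ z, f z ∂vertexLaw p r (pairAt u x j) := by
    rw [← Measure.infinitePi_map_eval (fun j : ℤ ↦ vertexLaw p r (pairAt u x j)) j,
      integral_map (measurable_pi_apply j).aemeasurable
        (measurable_of_countable f).aestronglyMeasurable]
  rw [lineLaw, integral_map (measurable_ofPairs u).aemeasurable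
    (measurable_spin_apply i).aestronglyMeasurable]
  by_cases h : (i + u) % 2 = 0
  · simp only [ofPairs, partner, if_pos h]
    rw [hev (fun z ↦ spin z.1), integral_spin_fst_vertexLaw]
    have h₁ : 2 * ((i + u) / 2) - u = i := by omega
    simp only [pairAt, h₁]
  · simp only [ofPairs, partner, if_neg h]
    rw [hev (fun z ↦ spin z.2), integral_spin_snd_vertexLaw]
    have h₂ : 2 * ((i + u) / 2) - u = i - 1 := by omega
    simp only [pairAt, h₂, sub_add_cancel]

instance (μ : Measure Line) [IsProbabilityMeasure μ] (p r : I) :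
    IsProbabilityMeasure (orientationLaw μ p r) := by
  unfold orientationLaw; infer_instance

theorem measurable_spin_edge (t : ℕ) (i : ℤ) :
    Measurable fun ω : Orientation ↦ spin (ω t i) :=
  measurable_spin.comp ((measurable_pi_apply i).comp (measurable_pi_apply t))

theorem integrable_mul_spin (P : Measure Orientation) [IsProbabilityMeasure P] {g : Line → ℝ}
    (hg : Measurable g) (hb : ∀ x, ‖g x‖ ≤ 1) (t : ℕ) (i : ℤ) :
    Integrable (fun ω : Orientation ↦ g (ω 0) * spin (ω t i)) P := by
  refine Integrable.of_bound ((hg.comp (measurable_pi_apply 0)).mul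
    (measurable_spin_edge t i)).aestronglyMeasurable 1 (ae_of_all _ fun ω ↦ ?_)
  rw [norm_mul, norm_spin, mul_one]
  exact hb _

/-- One step of the chain acts linearly on the correlations of spins with the initial line. -/
theorem integral_mul_spin_succ (μ : Measure Line) [IsProbabilityMeasure μ] (p r : I)
    {g : Line → ℝ} (hg : Measurable g) (hb : ∀ x, ‖g x‖ ≤ 1) (t : ℕ) (i : ℤ) :
    ∫ ω, g (ω 0) * spin (ω (t + 1) i) ∂orientationLaw μ p r =
      ((r : ℝ) - p) * ∫ ω, g (ω 0) * spin (ω t i) ∂orientationLaw μ p r +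
      ((r : ℝ) + p - 1) *
        ∫ ω, g (ω 0) * spin (ω t (partner (t % 2 : ℕ) i)) ∂orientationLaw μ p r := by
  -- The joint law of the past and of line t + 1 is a composition product, so line t + 1 can be
  -- integrated out first.
  have hjoint := Kernel.map_frestrictLe_trajMeasure_compProd_eq_map_trajMeasure
    (X := fun _ ↦ Line) (μ₀ := μ) (κ := lineKernel p r) (a := t)
  let F : (Π _ : Finset.Iic t, Line) × Line → ℝ :=
    fun z ↦ g (z.1 ⟨0, Finset.mem_Iic.2 (Nat.zero_le t)⟩) * spin (z.2 i)
  have hF : Measurable F :=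
    (hg.comp ((measurable_pi_apply _).comp measurable_fst)).mul
      (measurable_spin.comp ((measurable_pi_apply i).comp measurable_snd))
  have hFb (z) : ‖F z‖ ≤ 1 := by
    rw [norm_mul, norm_spin, mul_one]; exact hb _
  have h₁ : ∫ ω, g (ω 0) * spin (ω (t + 1) i) ∂orientationLaw μ p r =
      ∫ z, F z ∂((orientationLaw μ p r).map (Preorder.frestrictLe t) ⊗ₘ lineKernel p r t) := by
    unfold orientationLaw
    rw [hjoint, integral_map (by fun_prop) hF.aestronglyMeasurable]
    rfl
  have : IsProbabilityMeasure ((orientationLaw μ p r).map (Preorder.frestrictLe t)) :=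
    Measure.isProbabilityMeasure_map (by fun_prop)
  rw [h₁, Measure.integral_compProd
    (Integrable.of_bound hF.aestronglyMeasurable 1 (ae_of_all _ hFb))]
  have h₂ (h : Π _ : Finset.Iic t, Line) : ∫ y, F (h, y) ∂lineKernel p r t h =
      g (h ⟨0, Finset.mem_Iic.2 (Nat.zero_le t)⟩) *
        (((r : ℝ) - p) * spin (h ⟨t, Finset.mem_Iic.2 le_rfl⟩ i) + ((r : ℝ) + p - 1) *
          spin (h ⟨t, Finset.mem_Iic.2 le_rfl⟩ (partner (t % 2 : ℕ) i))) := by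
    rw [← integral_spin_lineLaw, ← integral_const_mul]
    rfl
  simp_rw [h₂]
  have hm (j : ℤ) : Measurable fun h : Π _ : Finset.Iic t, Line ↦
      spin (h ⟨t, Finset.mem_Iic.2 le_rfl⟩ j) :=
    measurable_spin.comp ((measurable_pi_apply j).comp (measurable_pi_apply _))
  have hm' : Measurable fun h : Π _ : Finset.Iic t, Line ↦
      g (h ⟨0, Finset.mem_Iic.2 (Nat.zero_le t)⟩) *
        (((r : ℝ) - p) * spin (h ⟨t, Finset.mem_Iic.2 le_rfl⟩ i) + ((r : ℝ) + p - 1) *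
          spin (h ⟨t, Finset.mem_Iic.2 le_rfl⟩ (partner (t % 2 : ℕ) i))) :=
    (hg.comp (measurable_pi_apply _)).mul (((hm _).const_mul _).add ((hm _).const_mul _))
  rw [integral_map (by fun_prop) hm'.aestronglyMeasurable,
    ← integral_const_mul, ← integral_const_mul, ← integral_add
      ((integrable_mul_spin _ hg hb _ _).const_mul _)
      ((integrable_mul_spin _ hg hb _ _).const_mul _)]
  refine integral_congr_ae (ae_of_all _ fun ω ↦ ?_)
  simp only [Preorder.frestrictLe_apply]
  ring

/-! ### Initial line and reduction of C₈ to `corr` -/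

theorem map_eval_zero_orientationLaw (μ : Measure Line) [IsProbabilityMeasure μ] (p r : I) :
    (orientationLaw μ p r).map (fun ω ↦ ω 0) = μ := by
  have h : (fun ω : Orientation ↦ ω 0) =
      (fun x : Π _ : Finset.Iic 0, Line ↦ x ⟨0, Finset.mem_Iic.2 le_rfl⟩) ∘
        Preorder.frestrictLe (π := fun _ ↦ Line) 0 := rfl
  rw [h, ← Measure.map_map (by fun_prop) (by fun_prop), orientationLaw, Kernel.trajMeasure,
    Measure.map_comp _ _ (by fun_prop), Kernel.traj_map_frestrictLe, Kernel.partialTraj_self,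
    Measure.id_comp, Measure.map_map (by fun_prop) (by fun_prop)]
  exact Measure.map_id

theorem integral_spin_bernoulliMeasure :
    ∫ b, spin b ∂bernoulliMeasure true false ⟨1 / 2, by norm_num, by norm_num⟩ = 0 := by
  rw [integral_bernoulliMeasure]
  norm_num [spin]

theorem integral_spin_productBernoulli (i : ℤ) :
    ∫ x, spin (x i) ∂productBernoulli ⟨1 / 2, by norm_num, by norm_num⟩ = 0 := by
  have h := integral_spin_bernoulliMeasure
  rwa [← Measure.infinitePi_map_eval (fun _ : ℤ ↦
    bernoulliMeasure true false ⟨1 / 2, by norm_num, by norm_num⟩) i,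
    integral_map (measurable_pi_apply i).aemeasurable
      measurable_spin.aestronglyMeasurable] at h

theorem integral_spin_mul_spin_productBernoulli (i : ℤ) :
    ∫ x, spin (x 0) * spin (x i) ∂productBernoulli ⟨1 / 2, by norm_num, by norm_num⟩ =
      if i = 0 then 1 else 0 := by
  split_ifs with hi
  · subst hi
    simp [spin_mul_self]
  · have hind := iIndepFun_infinitePi (P := fun _ : ℤ ↦
      bernoulliMeasure true false ⟨1 / 2, by norm_num, by norm_num⟩)
      (X := fun _ ↦ spin) (fun _ ↦ measurable_spin)
    have h := (hind.indepFun (Ne.symm hi)).integral_fun_mul_eq_mul_integral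
      (measurable_spin.comp (measurable_pi_apply 0)).aestronglyMeasurable
      (measurable_spin.comp (measurable_pi_apply i)).aestronglyMeasurable
    have h₀ := integral_spin_productBernoulli 0
    rw [productBernoulli] at h₀ ⊢
    rw [h, h₀, zero_mul]

/-- The evolution of the correlations with a fixed spin of the initial line: `corr α β t i` is the
expectation of the product of the spins at `(0, 0)` and `(i, t)`. -/
def corr (α β : ℝ) : ℕ → ℤ → ℝ
  | 0, i => if i = 0 then 1 else 0
  | t + 1, i => α * corr α β t i + β * corr α β t (partner (t % 2 : ℕ) i)

theorem integral_eval_zero_orientationLaw (μ : Measure Line) [IsProbabilityMeasure μ] (p r : I)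
    {f : Line → ℝ} (hf : Measurable f) :
    ∫ ω, f (ω 0) ∂orientationLaw μ p r = ∫ x, f x ∂μ := by
  conv_rhs => rw [← map_eval_zero_orientationLaw μ p r]
  rw [integral_map (measurable_pi_apply 0).aemeasurable hf.aestronglyMeasurable]

theorem integral_spin_mul_spin (p r : I) (t : ℕ) (i : ℤ) :
    ∫ ω, spin (ω 0 0) * spin (ω t i)
      ∂orientationLaw (productBernoulli ⟨1 / 2, by norm_num, by norm_num⟩) p r =
      corr ((r : ℝ) - p) ((r : ℝ) + p - 1) t i := by
  induction t generalizing i with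
  | zero =>
    rw [integral_eval_zero_orientationLaw _ p r
      (f := fun x ↦ spin (x 0) * spin (x i))
      ((measurable_spin_apply 0).mul (measurable_spin_apply i)),
      integral_spin_mul_spin_productBernoulli, corr]
  | succ t ih =>
    rw [integral_mul_spin_succ _ p r (g := fun x ↦ spin (x 0)) (measurable_spin_apply 0)
      (fun x ↦ (norm_spin _).le), ih, ih, corr]

theorem integral_spin (p r : I) (t : ℕ) (i : ℤ) :
    ∫ ω, spin (ω t i)
      ∂orientationLaw (productBernoulli ⟨1 / 2, by norm_num, by norm_num⟩) p r = 0 := by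
  induction t generalizing i with
  | zero =>
    rw [integral_eval_zero_orientationLaw _ p r (f := fun x ↦ spin (x i))
      (measurable_spin_apply i), integral_spin_productBernoulli]
  | succ t ih =>
    -- With the constant 1 as test function, the correlation recursion becomes one for the means.
    have h := integral_mul_spin_succ (productBernoulli ⟨1 / 2, by norm_num, by norm_num⟩) p r
      (g := fun _ ↦ 1) measurable_const (fun x ↦ by simp) t i
    simpa only [one_mul, ih, mul_zero, add_zero] using h

theorem edge_eq_spin (i : ℤ) (t : ℕ) :
    edge i t = fun ω ↦ 1 / 2 + 1 / 2 * spin (ω t i) := by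
  funext ω
  unfold edge spin
  split_ifs <;> norm_num

theorem covariance_edge {P : Measure Orientation} [IsProbabilityMeasure P] {i j : ℤ} {s t : ℕ}
    (hi : ∫ ω, spin (ω s i) ∂P = 0) (hj : ∫ ω, spin (ω t j) ∂P = 0) :
    covariance (edge i s) (edge j t) P = 1 / 4 * ∫ ω, spin (ω s i) * spin (ω t j) ∂P := by
  have hint (k : ℤ) (n : ℕ) : Integrable (fun ω : Orientation ↦ 1 / 2 * spin (ω n k)) P := by
    refine (Integrable.of_bound (measurable_spin_edge n k).aestronglyMeasurable 1
      (ae_of_all _ fun ω ↦ (norm_spin _).le)).const_mul _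
  rw [edge_eq_spin, edge_eq_spin, covariance_const_add_left (hint i s),
    covariance_const_add_right (hint j t), covariance_const_mul_left, covariance_const_mul_right,
    covariance, hi, hj]
  simp only [sub_zero]
  ring

theorem variance_edge {P : Measure Orientation} [IsProbabilityMeasure P] {i : ℤ} {t : ℕ}
    (hi : ∫ ω, spin (ω t i) ∂P = 0) : variance (edge i t) P = 1 / 4 := by
  have hm : Measurable (edge i t) := by
    rw [edge_eq_spin]
    exact ((measurable_spin_edge t i).const_mul _).const_add _
  rw [← covariance_self hm.aemeasurable, covariance_edge hi hi]
  simp [spin_mul_self]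

/-- All spins are centred, so both variances are 1/4 and cancel the factor 1/4 of the covariance. -/
theorem C8_eq_corr (a b c d : ℝ≥0) (i : ℤ) (t : ℕ) :
    C8 a b c d i t = corr ((ratio b d : ℝ) - ratio a c) ((ratio b d : ℝ) + ratio a c - 1) t i := by
  rw [C8, edgeCorrelation, eightVertexLaw,
    variance_edge (integral_spin _ _ _ _), variance_edge (integral_spin _ _ _ _),
    covariance_edge (integral_spin _ _ _ _) (integral_spin _ _ _ _), integral_spin_mul_spin,
    Real.mul_self_sqrt (by norm_num)]
  ring

/-! ### Two-step operators -/

/-- The transition operator of the simple random walk on `ℤ`. -/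
noncomputable def avg (f : ℤ → ℝ) (x : ℤ) : ℝ := (f (x + 1) + f (x - 1)) / 2

/-- The operator that stays put with weight `α ^ 2` and jumps by two, in a direction given by the
parity of `x + u`, with weight `β ^ 2`. -/
def hop (α β : ℝ) (u : ℤ) (f : ℤ → ℝ) (x : ℤ) : ℝ :=
  α ^ 2 * f x + β ^ 2 * f (if (x + u) % 2 = 0 then x - 2 else x + 2)

/-- Averaging only looks at x ± 1, whose parity is opposite to that of x; hence the shift of u. -/
theorem avg_hop (α β : ℝ) (u : ℤ) (f : ℤ → ℝ) :
    avg (hop α β u f) = hop α β (u + 1) (avg f) := by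
  funext x
  by_cases h : (x + (u + 1)) % 2 = 0
  · have h₁ : (x + 1 + u) % 2 = 0 := by omega
    have h₂ : (x - 1 + u) % 2 = 0 := by omega
    simp only [avg, hop, h, h₁, h₂, if_true]
    rw [show x + 1 - 2 = x - 2 + 1 by ring, show x - 1 - 2 = x - 2 - 1 by ring]
    ring
  · have h₁ : ¬ (x + 1 + u) % 2 = 0 := by omega
    have h₂ : ¬ (x - 1 + u) % 2 = 0 := by omega
    simp only [avg, hop, h, h₁, h₂, if_false]
    rw [show x + 1 + 2 = x + 2 + 1 by ring, show x - 1 + 2 = x + 2 - 1 by ring]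
    ring

theorem iterate_avg_hop (α β : ℝ) (k : ℕ) (u : ℤ) (f : ℤ → ℝ) :
    avg^[k] (hop α β u f) = hop α β (u + k) (avg^[k] f) := by
  induction k generalizing u f with
  | zero => simp
  | succ k ih =>
    rw [Function.iterate_succ_apply, Function.iterate_succ_apply, avg_hop, ih]
    congr 1
    push_cast
    ring

theorem iterate_avg_mul_add (k : ℕ) (a : ℝ) (f g : ℤ → ℝ) (x : ℤ) :
    avg^[k] (fun y ↦ a * f y + g y) x = a * avg^[k] f x + avg^[k] g x := by
  induction k generalizing f g with
  | zero => rfl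
  | succ k ih =>
    simp only [Function.iterate_succ_apply]
    have h : avg (fun y ↦ a * f y + g y) = fun y ↦ a * avg f y + avg g y := by
      funext y
      simp only [avg]
      ring
    rw [h, ih]

theorem corr_two_mul_succ (α β : ℝ) (n : ℕ) :
    corr α β (2 * (n + 1)) =
      fun x ↦ 2 * α * β * avg (corr α β (2 * n)) x + hop α β 0 (corr α β (2 * n)) x := by
  funext x
  have h₀ : (2 * n) % 2 = 0 := by omega
  have h₁ : (2 * n + 1) % 2 = 1 := by omega
  rw [show 2 * (n + 1) = 2 * n + 1 + 1 by ring]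
  simp only [corr, h₀, h₁, partner, avg, hop, Nat.cast_zero, Nat.cast_one, add_zero]
  by_cases h : x % 2 = 0
  · have h₂ : ¬ (x + 1) % 2 = 0 := by omega
    have h₃ : ¬ (x - 1) % 2 = 0 := by omega
    simp only [h, h₂, h₃, if_true, if_false]
    rw [show x - 1 - 1 = x - 2 by ring]
    ring
  · have h₂ : (x + 1) % 2 = 0 := by omega
    simp only [h, h₂, if_true, if_false]
    rw [show x + 1 + 1 = x + 2 by ring]
    ring

/-! ### Return bounds for the simple random walk -/

theorem choose_half_sq_le (n : ℕ) : n.choose (n / 2) ^ 2 * (n + 1) ≤ 4 ^ n := by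
  have heven (m : ℕ) : m.centralBinom ^ 2 * (2 * m + 1) ≤ 16 ^ m := by
    induction m with
    | zero => simp
    | succ m ih =>
      have h := m.succ_mul_centralBinom_succ
      -- The factor (m + 1)² makes room for the recursion of central binomials; what remains is (2m
      -- + 1)(2m + 3) ≤ 4(m + 1)².
      refine le_of_mul_le_mul_left (a := (m + 1) ^ 2) ?_ (pow_pos m.succ_pos 2)
      calc (m + 1) ^ 2 * ((m + 1).centralBinom ^ 2 * (2 * (m + 1) + 1))
          = ((m + 1) * (m + 1).centralBinom) ^ 2 * (2 * m + 3) := by ring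
        _ = 4 * ((2 * m + 1) * (2 * m + 3)) * (m.centralBinom ^ 2 * (2 * m + 1)) := by
          rw [h]; ring
        _ ≤ 4 * (4 * (m + 1) ^ 2) * 16 ^ m :=
          Nat.mul_le_mul (Nat.mul_le_mul_left _ (by nlinarith)) ih
        _ = (m + 1) ^ 2 * 16 ^ (m + 1) := by ring
  obtain ⟨m, rfl | rfl⟩ := n.even_or_odd'
  · have h := heven m
    rw [Nat.centralBinom] at h
    rw [Nat.mul_div_cancel_left m two_pos, pow_mul]
    exact h
  · have h := heven (m + 1)
    have h₁ : (m + 1).centralBinom = 2 * (2 * m + 1).choose m := by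
      rw [Nat.centralBinom, show 2 * (m + 1) = 2 * m + 1 + 1 by ring, Nat.choose_succ_succ,
        Nat.choose_symm_half]
      ring
    rw [h₁] at h
    rw [show (2 * m + 1) / 2 = m by omega, pow_succ 4, pow_mul]
    norm_num
    have h₂ : (16 : ℕ) ^ (m + 1) = 16 * 16 ^ m := by ring
    nlinarith [sq_nonneg ((2 * m + 1).choose m)]

theorem choose_div_two_pow_le (n j : ℕ) : (n.choose j : ℝ) / 2 ^ n ≤ 1 / √(n + 1) := by
  have h₁ : ((n.choose j : ℝ)) ^ 2 * (n + 1) ≤ (2 ^ n) ^ 2 := by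
    rw [← pow_mul, mul_comm n 2, pow_mul]
    norm_num
    exact_mod_cast (Nat.mul_le_mul_right _ (Nat.pow_le_pow_left (Nat.choose_le_middle j n) 2)).trans
      (choose_half_sq_le n)
  rw [div_le_div_iff₀ (by positivity) (by positivity), one_mul]
  refine abs_le_of_sq_le_sq' ?_ (by positivity) |>.2
  rwa [mul_pow, Real.sq_sqrt (by positivity)]

/-- The law of the simple random walk at time `k`. -/
theorem iterate_avg_indicator (k : ℕ) :
    (∀ j : ℕ, avg^[k] (fun x ↦ if x = 0 then 1 else 0) (2 * j - k) = k.choose j / 2 ^ k) ∧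
    ∀ x : ℤ, (x < -k ∨ (x + k) % 2 = 1) → avg^[k] (fun x ↦ if x = 0 then 1 else 0) x = 0 := by
  induction k with
  | zero =>
    refine ⟨fun j ↦ ?_, fun x hx ↦ ?_⟩
    · rcases j with _ | j
      · simp
      · have : ¬ (2 * ((j + 1 : ℕ) : ℤ) - (0 : ℕ) = 0) := by omega
        simp [Nat.choose_eq_zero_of_lt]
        omega
    · have : x ≠ 0 := by rintro rfl; simp at hx
      simp [this]
  | succ k ih =>
    obtain ⟨ih₁, ih₂⟩ := ih
    simp only [Function.iterate_succ_apply', avg]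
    refine ⟨fun j ↦ ?_, fun x hx ↦ ?_⟩
    · rw [show 2 * (j : ℤ) - (k + 1 : ℕ) + 1 = 2 * j - k by push_cast; ring, ih₁]
      rcases j with _ | j
      · rw [ih₂ _ (Or.inl (by push_cast; omega))]
        simp only [Nat.choose_zero_right]
        ring
      · rw [show 2 * ((j + 1 : ℕ) : ℤ) - (k + 1 : ℕ) - 1 = 2 * j - k by push_cast; ring, ih₁,
          Nat.choose_succ_succ]
        push_cast
        ring
    · rw [ih₂ _ (by omega), ih₂ _ (by omega)]
      simp

theorem abs_iterate_avg_indicator_le (k : ℕ) (x : ℤ) :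
    |avg^[k] (fun x ↦ if x = 0 then 1 else 0) x| ≤ 1 / √(k + 1) := by
  by_cases hx : x < -k ∨ (x + k) % 2 = 1
  · rw [(iterate_avg_indicator k).2 x hx, abs_zero]
    positivity
  · obtain ⟨j, hj⟩ := Int.eq_ofNat_of_zero_le (a := (x + k) / 2) (by omega)
    have h : x = 2 * j - k := by omega
    rw [h, (iterate_avg_indicator k).1 j, abs_of_nonneg (by positivity)]
    exact choose_div_two_pow_le k j

/-! ### Decay of the correlations -/

/-- A quantitative convexity inequality for `y ↦ 1 / √y`. -/
theorem convexCombo_inv_sqrt_le {s y : ℝ} (hs₀ : 0 ≤ s) (hy : 1 ≤ y) :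
    s * (1 / √(y + 1)) + (1 - s) * (1 / √y) ≤ 1 / √(y + s / 4) := by
  have ha : 0 < √y := Real.sqrt_pos.2 (by linarith)
  have ha' : √y ^ 2 = y := Real.sq_sqrt (by linarith)
  have hb' : √(y + 1) ^ 2 = y + 1 := Real.sq_sqrt (by linarith)
  have hc' : √(y + s / 4) ^ 2 = y + s / 4 := Real.sq_sqrt (by linarith)
  have hab : √y ≤ √(y + 1) := Real.sqrt_le_sqrt (by linarith)
  have hac : √y ≤ √(y + s / 4) := Real.sqrt_le_sqrt (by linarith)
  set a := √y
  set b := √(y + 1)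
  set c := √(y + s / 4)
  have hb : 0 < b := ha.trans_le hab
  have hc : 0 < c := ha.trans_le hac
  -- This uses y ≥ 1. It gives ab(a + b) ≤ 6a³ ≤ 8a³, so the gain s(1/a - 1/b) is at least s/(8a³),
  -- and the shift s/4 costs at most that.
  have hba : b ≤ 2 * a := by nlinarith
  have h₁ : 1 / a - 1 / c ≤ s / (8 * a ^ 3) := by
    have h : 1 / a - 1 / c = s / 4 / (a * c * (a + c)) := by
      field_simp
      nlinarith
    rw [h, div_div]
    refine div_le_div_of_nonneg_left hs₀ (by positivity) ?_
    calc 8 * a ^ 3 = 4 * (a * a * (a + a)) := by ring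
      _ ≤ 4 * (a * c * (a + c)) := by gcongr
  have h₂ : 1 / (8 * a ^ 3) ≤ 1 / a - 1 / b := by
    have h : 1 / a - 1 / b = 1 / (a * b * (a + b)) := by
      field_simp
      nlinarith
    rw [h]
    refine div_le_div_of_nonneg_left zero_le_one (by positivity) ?_
    calc a * b * (a + b) ≤ a * (2 * a) * (a + 2 * a) := by gcongr
      _ ≤ 8 * a ^ 3 := by nlinarith [pow_pos ha 3]
  have h₃ := mul_le_mul_of_nonneg_left h₂ hs₀
  rw [mul_one_div] at h₃
  linarith

/-- Uniform bound for the correlations at even times, smoothed by the simple random walk. -/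
theorem abs_iterate_avg_corr_le {α β : ℝ} (hα : α ≠ 0) (k n : ℕ) (x : ℤ) :
    |avg^[k] (corr α β (2 * n)) x| ≤ (|α| + |β|) ^ (2 * n) *
      (1 / √(k + n * (2 * |α| * |β| / (|α| + |β|) ^ 2 / 4) + 1)) := by
  have hl : 0 < |α| + |β| := by positivity
  set l := |α| + |β| with hl_def
  -- s is the share of the random walk step in the total weight l² of two time steps.
  set s := 2 * |α| * |β| / l ^ 2 with hs_def
  have hs : l ^ 2 * s = 2 * |α| * |β| := by rw [hs_def]; field_simp
  have hs' : l ^ 2 * (1 - s) = α ^ 2 + β ^ 2 := by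
    rw [mul_sub, hs, hl_def, ← sq_abs α, ← sq_abs β]; ring
  have hs₀ : 0 ≤ s := by positivity
  -- The bound is needed for all k at once: the walk part of a double step raises k by one.
  induction n generalizing k x with
  | zero => simpa [corr] using abs_iterate_avg_indicator_le k x
  | succ n ih =>
    have hhop (u : ℤ) (f : ℤ → ℝ) (M : ℝ) (hf : ∀ z, |f z| ≤ M) :
        |hop α β u f x| ≤ (α ^ 2 + β ^ 2) * M := by
      refine (abs_add_le _ _).trans ?_
      rw [abs_mul, abs_mul, abs_of_nonneg (sq_nonneg α), abs_of_nonneg (sq_nonneg β), add_mul]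
      gcongr <;> apply hf
    rw [corr_two_mul_succ, iterate_avg_mul_add, iterate_avg_hop, ← Function.iterate_succ_apply]
    have h₁ := ih (k + 1) x
    have h₂ := hhop (0 + k) _ _ (ih k)
    set y : ℝ := k + n * (s / 4) + 1 with hy_def
    have hy : 1 ≤ y := by
      have : 0 ≤ (k : ℝ) + n * (s / 4) := by positivity
      linarith
    rw [show ((k + 1 : ℕ) : ℝ) + n * (s / 4) + 1 = y + 1 by push_cast; ring] at h₁
    rw [show (k : ℝ) + (n + 1 : ℕ) * (s / 4) + 1 = y + s / 4 by push_cast; ring]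
    calc _ ≤ |2 * α * β * avg^[k + 1] (corr α β (2 * n)) x| +
          |hop α β (0 + k) (avg^[k] (corr α β (2 * n))) x| := abs_add_le _ _
      _ ≤ 2 * |α| * |β| * (l ^ (2 * n) * (1 / √(y + 1))) +
          (α ^ 2 + β ^ 2) * (l ^ (2 * n) * (1 / √y)) := by
        refine add_le_add ?_ h₂
        rw [abs_mul, abs_mul, abs_mul, abs_two]
        gcongr
      _ = l ^ (2 * (n + 1)) * (s * (1 / √(y + 1)) + (1 - s) * (1 / √y)) := by
        rw [← hs, ← hs']; ring
      _ ≤ _ := by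
        gcongr
        exact convexCombo_inv_sqrt_le hs₀ hy

theorem corr_zero_right (α : ℝ) (t : ℕ) (i : ℤ) :
    corr α 0 t i = if i = 0 then α ^ t else 0 := by
  induction t generalizing i with
  | zero => simp [corr]
  | succ t ih =>
    rw [corr, zero_mul, add_zero, ih]
    split_ifs <;> ring

/-- The alternating pairings carry the site t to t + 1 at step t, so the mass moves ballistically to
the right. -/
theorem corr_zero_left (β : ℝ) (t : ℕ) (i : ℤ) :
    corr 0 β t i = if i = t then β ^ t else 0 := by
  induction t generalizing i with
  | zero => simp [corr]
  | succ t ih =>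
    rw [corr, zero_mul, zero_add, ih]
    have h : partner (t % 2 : ℕ) i = t ↔ i = (t + 1 : ℕ) := by
      unfold partner
      split_ifs <;> omega
    simp only [h]
    split_ifs <;> ring

/-- Uniform bound for the correlations. -/
theorem abs_corr_le {α β : ℝ} (hα : α ≠ 0) (t : ℕ) (i : ℤ) :
    |corr α β t i| ≤ (|α| + |β|) ^ t *
      (1 / √((t / 2 : ℕ) * (2 * |α| * |β| / (|α| + |β|) ^ 2 / 4) + 1)) := by
  obtain ⟨n, rfl | rfl⟩ := t.even_or_odd'
  · have h := abs_iterate_avg_corr_le (β := β) hα 0 n i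
    rw [Nat.mul_div_cancel_left n two_pos]
    simpa only [Function.iterate_zero, id, Nat.cast_zero, zero_add] using h
  · have h := abs_iterate_avg_corr_le (β := β) hα 0 n
    simp only [Function.iterate_zero, id, Nat.cast_zero, zero_add] at h
    rw [show (2 * n + 1) / 2 = n by omega, corr, pow_succ']
    refine (abs_add_le _ _).trans ?_
    rw [abs_mul, abs_mul, mul_assoc, add_mul]
    exact add_le_add (mul_le_mul_of_nonneg_left (h _) (abs_nonneg _))
      (mul_le_mul_of_nonneg_left (h _) (abs_nonneg _))

theorem corr_isBigO {α β : ℝ} (hβ : β ≠ 0) (i : ℤ) :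
    (fun t ↦ corr α β t i) =O[atTop] fun t : ℕ ↦ (|α| + |β|) ^ t / √t := by
  by_cases hα : α = 0
  · subst hα
    refine IsBigO.of_bound 0 ?_
    filter_upwards [eventually_gt_atTop i.toNat] with t ht
    rw [corr_zero_left, if_neg (by omega)]
    simp
  · set s := 2 * |α| * |β| / (|α| + |β|) ^ 2 / 4 with hs
    have hs₀ : 0 < s := by positivity
    -- Since t ≤ 2⌊t/2⌋ + 1, this minimum c satisfies ct ≤ s⌊t/2⌋ + 1.
    have hc : 0 < min (s / 2) (1 / 2) := by positivity
    set c := min (s / 2) (1 / 2) with hc_def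
    refine IsBigO.of_bound (1 / √c) ?_
    filter_upwards [eventually_gt_atTop 0] with t ht
    have ht' : (0 : ℝ) < t := by exact_mod_cast ht
    have h := abs_corr_le (β := β) hα t i
    rw [← hs] at h
    rw [Real.norm_eq_abs, Real.norm_of_nonneg (by positivity)]
    refine h.trans ?_
    rw [show 1 / √c * ((|α| + |β|) ^ t / √t) = (|α| + |β|) ^ t * (1 / (√c * √t)) by
      field_simp, ← Real.sqrt_mul hc.le]
    gcongr
    have h₁ : (t : ℝ) ≤ 2 * (t / 2 : ℕ) + 1 := by
      have : t ≤ 2 * (t / 2) + 1 := by omega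
      exact_mod_cast this
    have h₂ : c ≤ s / 2 := min_le_left _ _
    have h₃ : c ≤ 1 / 2 := min_le_right _ _
    have h₄ : (0 : ℝ) ≤ (t / 2 : ℕ) := Nat.cast_nonneg _
    nlinarith [mul_le_mul_of_nonneg_left h₁ hc.le, mul_le_mul_of_nonneg_right h₂ h₄]

/-- This is max(|α - β|, |α + β|) = |α| + |β|, as 1 - 2p = α - β and 2r - 1 = α + β. -/
theorem decayRate_eq (p r : ℝ) : decayRate p r = |r - p| + |r + p - 1| := by
  unfold decayRate
  rcases abs_cases (1 - 2 * p) with h | h <;> rcases abs_cases (1 - 2 * r) with h' | h' <;>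
    rcases abs_cases (r - p) with h₁ | h₁ <;> rcases abs_cases (r + p - 1) with h₂ | h₂ <;>
    rcases max_cases |1 - 2 * p| |1 - 2 * r| with h₃ | h₃ <;> linarith

end EightVertex

theorem mainTheorem2 (a b c d : ℝ≥0) (hpos : 0 < a + c) (hac : a + c = b + d)
    (p r : ℝ) (hp : p = a / (a + c)) (hr : r = b / (b + d)) :
    ((a = d ∧ b = c) ↔ p + r = 1) ∧
    (∀ i : ℤ,
      (a = d ∧ b = c → ∀ t : ℕ,
        EightVertex.C8 a b c d i t = if i = 0 then (1 - 2 * p) ^ t else 0) ∧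
      (¬ (a = d ∧ b = c) →
        (fun t : ℕ ↦ EightVertex.C8 a b c d i t) =O[atTop]
          fun t : ℕ ↦ EightVertex.decayRate p r ^ t / Real.sqrt t)) ∧
    (0 < a → 0 < b → 0 < c → 0 < d → EightVertex.decayRate p r < 1) ∧
    (d = 0 → EightVertex.decayRate p r = 1) := by
  have hpos' : (0 : ℝ) < a + c := by exact_mod_cast hpos
  have hac' : (a : ℝ) + c = b + d := by exact_mod_cast hac
  have hp' : p * (a + c) = a := by rw [hp]; field_simp
  have hr' : r * (a + c) = b := by rw [hr, ← hac']; field_simp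
  have hC (i : ℤ) (t : ℕ) : EightVertex.C8 a b c d i t =
      EightVertex.corr (r - p) (r + p - 1) t i := by
    rw [EightVertex.C8_eq_corr, hp, hr]
    rfl
  have hiff : (a = d ∧ b = c) ↔ p + r = 1 := by
    constructor
    · rintro ⟨rfl, rfl⟩
      refine mul_right_cancel₀ hpos'.ne' ?_
      linarith
    · intro h
      have h₁ : (p + r) * (a + c) = a + c := by rw [h, one_mul]
      have h₂ : (b : ℝ) = c := by linarith
      have h₃ : (a : ℝ) = d := by linarith
      exact ⟨by exact_mod_cast h₃, by exact_mod_cast h₂⟩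
  refine ⟨hiff, fun i ↦ ⟨fun h t ↦ ?_, fun h ↦ ?_⟩, fun ha hb hc hd ↦ ?_, fun hd ↦ ?_⟩
  · have h₁ := hiff.1 h
    rw [hC, show r + p - 1 = 0 by linarith, show r - p = 1 - 2 * p by linarith,
      EightVertex.corr_zero_right]
  · rw [hiff] at h
    simp only [hC, EightVertex.decayRate_eq]
    exact EightVertex.corr_isBigO (fun h₁ ↦ h (by linarith)) i
  · have ha' : (0 : ℝ) < a := by exact_mod_cast ha
    have hb' : (0 : ℝ) < b := by exact_mod_cast hb
    have hc' : (0 : ℝ) < c := by exact_mod_cast hc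
    have hd' : (0 : ℝ) < d := by exact_mod_cast hd
    have hp₀ : 0 < p := by rw [hp]; positivity
    have hr₀ : 0 < r := by rw [hr]; positivity
    have hp₁ : p < 1 := by rw [hp, div_lt_one hpos']; linarith
    have hr₁ : r < 1 := by rw [hr, div_lt_one (by positivity)]; linarith
    rw [EightVertex.decayRate, max_lt_iff, abs_lt, abs_lt]
    refine ⟨⟨?_, ?_⟩, ?_, ?_⟩ <;> linarith
  · subst hd
    have hr₁ : r = 1 := by
      refine mul_right_cancel₀ hpos'.ne' ?_
      rw [hr', one_mul, hac']
      simp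
    have hp₀ : 0 ≤ p := by rw [hp]; positivity
    have hp₁ : p ≤ 1 := by rw [hp, div_le_one hpos']; linarith [c.2]
    rw [EightVertex.decayRate, hr₁]
    norm_num
    rw [abs_le]
    constructor <;> linarith
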